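/- Let $f:\{1,2,3,\dots\}\to\mathbb{R}$ be an additive arithmetic function, i.e. $f(1)=0$ and $f(mn)=f(m)+f(n)$ whenever $\gcd(m,n)=1$. Suppose that for every $t\in\mathbb{R}$ $$\sum_{n=1}^{\infty}\frac{\left|(e^{itf}*\mu)(n)\right|}{n}<\infty,$$ where $e^{itf}$ denotes the function $n\mapsto e^{itf(n)}$, $\mu$ is the Möbius function and $*$ is Dirichlet convolution, $(g*h)(n)=\sum_{d\mid n}g(d)h(n/d)$. Then $f$ has a limit distribution: there is a probability measure $P$ on $\mathbb{R}$, with distribution function $F(y)=P((-\infty,y])$, such that $$F_n(y)=\frac{1}{n}\,\#\{m\in\{1,\dots,n\}: f(m)\le y\}\longrightarrow F(y)\qquad(n\to\infty)$$ at every point $y$ at which $F$ is continuous. Moreover, its characteristic function $\varphi_f(t)=\int_{\mathbb{R}}e^{itx}\,dP(x)$ is given, for every $t\in\mathbb{R}$, by $$\varphi_f(t)=\prod_{p}\left(1-\frac1p\right)\sum_{\alpha\ge 0}\frac{e^{itf(p^{\alpha})}}{p^{\alpha}},$$ where the product runs over all primes $p$, the inner series converge absolutely, and the finite partial products converge to $\varphi_f(t)$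 unconditionally (independently of the order of the primes). -/

import Mathlib

namespace AdditiveArith

/-- A real arithmetic function is additive if `f 1 = 0` and `f (m * n) = f m + f n`
for coprime positive integers `m`, `n`. -/
def IsAdditive (f : ArithmeticFunction ℝ) : Prop :=
  f 1 = 0 ∧ ∀ m n : ℕ, 0 < m → 0 < n → m.Coprime n → f (m * n) = f m + f n

/-- The complex arithmetic function `n ↦ e^{i t f(n)}` on the positive integers
(arithmetic functions take the value `0` at `0` by convention). -/
noncomputable def expArith (f : ArithmeticFunction ℝ) (t : ℝ) : ArithmeticFunction ℂ where
  toFun n := if n = 0 then 0 else Complex.exp (Complex.I * (t : ℂ) * (f n : ℂ))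
  map_zero' := if_pos rfl

/-- The Dirichlet convolution `e^{i t f} * μ`, where `μ` is the Möbius function. -/
noncomputable def expConvMoebius (f : ArithmeticFunction ℝ) (t : ℝ) : ArithmeticFunction ℂ :=
  expArith f t * ((ArithmeticFunction.moebius : ArithmeticFunction ℤ) : ArithmeticFunction ℂ)

/-- The distribution function `F_n(y) = #{m ∈ {1, …, n} : f(m) ≤ y} / n` of `f` on
`{1, …, n}` with the uniform probability. -/
noncomputable def distFun (f : ArithmeticFunction ℝ) (n : ℕ) (y : ℝ) : ℝ :=
  (Set.ncard {m : ℕ | 1 ≤ m ∧ m ≤ n ∧ f m ≤ y} : ℝ) / (n : ℝ)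

/-- `f` has the limit distribution `P`: `P` is a probability measure on the line, and the
distribution functions `F_n` converge weakly to the distribution function of `P`, that is,
at each of its continuity points. -/
def HasLimitDistribution (f : ArithmeticFunction ℝ) (P : MeasureTheory.Measure ℝ) : Prop :=
  MeasureTheory.IsProbabilityMeasure P ∧
    ∀ y : ℝ, ContinuousAt (fun z : ℝ => ProbabilityTheory.cdf P z) y →
      Filter.Tendsto (fun n : ℕ => distFun f n y) Filter.atTop
        (nhds (ProbabilityTheory.cdf P y))

end AdditiveArith

/-! The mean of e^{itf} over {1, …, n} is the characteristic function of the law of f there. Writing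
e^{itf} = h_t * 1 with h_t = e^{itf} * μ, Wintner's theorem sends these means to ∑ h_t(n)/n, which
multiplicativity turns into the Euler product. Lévy's continuity theorem then gives the limit law,
provided the limit is continuous at t = 0.

That continuity is the delicate point, since summability is assumed only for each t separately. The
limit differs from 1 by at most exp(S(t)) - 1, where S(t) sums p^{-k} |e^{it(f(p^k) - f(p^{k-1}))} -
1| over prime powers with k ≥ 1. Baire category makes the tails of S uniformly small on some
interval, and subadditivity of |e^{itx} - 1| in t carries this interval to 0. -/

open Filter Topology MeasureTheory

namespace AdditiveArith

/-- If `∑ aᵢ |e^{i t xᵢ} - 1|` converges for every real `t`, then its sum tends to `0`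
as `t → 0`. -/
theorem tendsto_tsum_mul_norm_exp_sub_one {ι : Type*} [Countable ι] {a x : ι → ℝ}
    (ha : ∀ i, 0 ≤ a i)
    (h : ∀ t : ℝ, Summable fun i ↦ a i * ‖Complex.exp (Complex.I * t * x i) - 1‖) :
    Tendsto (fun t : ℝ ↦ ∑' i, a i * ‖Complex.exp (Complex.I * t * x i) - 1‖) (𝓝 0) (𝓝 0) := by
  classical
  set u : ℝ → ι → ℝ := fun t i ↦ a i * ‖Complex.exp (Complex.I * t * x i) - 1‖ with hu
  have hu0 (t i) : 0 ≤ u t i := mul_nonneg (ha i) (norm_nonneg _)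
  have hcont (i) : Continuous fun t ↦ u t i := by fun_prop
  have hsub (s t : ℝ) (i) : u t i ≤ u (s + t) i + u s i := by
    have hn : ‖Complex.exp (Complex.I * s * x i)‖ = 1 := by
      rw [show Complex.I * s * x i = ((s * x i : ℝ) : ℂ) * Complex.I by push_cast; ring,
        Complex.norm_exp_ofReal_mul_I]
    have hadd : Complex.exp (Complex.I * ((s + t : ℝ) : ℂ) * x i) =
        Complex.exp (Complex.I * s * x i) * Complex.exp (Complex.I * t * x i) := by
      rw [← Complex.exp_add]; push_cast; ring_nf
    simp only [hu]
    rw [← mul_add]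
    refine mul_le_mul_of_nonneg_left ?_ (ha i)
    calc ‖Complex.exp (Complex.I * t * x i) - 1‖
        = ‖Complex.exp (Complex.I * s * x i) * (Complex.exp (Complex.I * t * x i) - 1)‖ := by
          rw [norm_mul, hn, one_mul]
      _ = ‖(Complex.exp (Complex.I * ((s + t : ℝ) : ℂ) * x i) - 1) -
            (Complex.exp (Complex.I * s * x i) - 1)‖ := by rw [hadd]; ring_nf
      _ ≤ _ := norm_sub_le _ _
  rw [Metric.tendsto_nhds]
  intro ε hε
  -- Baire category: these closed sets, countably many because `ι` is countable, cover ℝ, so one of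
  -- them contains a neighbourhood of some `s`.
  let E : Finset ι → Set ℝ := fun F ↦
    {t | ∀ G : Finset ι, Disjoint G F → ∑ i ∈ G, u t i ≤ ε / 4}
  have hclosed (F) : IsClosed (E F) := by
    simp only [E, Set.ofPred_forall]
    exact isClosed_iInter fun G ↦ isClosed_iInter fun _ ↦
      isClosed_le (continuous_finsetSum _ fun i _ ↦ hcont i) continuous_const
  have hcover : ⋃ F, E F = Set.univ := by
    refine Set.eq_univ_of_forall fun t ↦ Set.mem_iUnion.2 ?_
    obtain ⟨F, hF⟩ := summable_iff_vanishing_norm.1 (h t) (ε / 4) (by positivity)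
    exact ⟨F, fun G hG ↦ (le_abs_self _).trans (hF G hG).le⟩
  obtain ⟨F, s, hs⟩ := nonempty_interior_of_iUnion_of_closed hclosed hcover
  have hsE : s ∈ E F := interior_subset hs
  have hnear : ∀ᶠ t in 𝓝 (0 : ℝ), s + t ∈ E F := by
    have hc : Tendsto (fun t : ℝ ↦ s + t) (𝓝 0) (𝓝 s) := by
      exact Continuous.tendsto' (by fun_prop) 0 s (add_zero s)
    exact hc.eventually (mem_interior_iff_mem_nhds.1 hs)
  have hfin : ∀ᶠ t in 𝓝 (0 : ℝ), ∑ i ∈ F, u t i < ε / 4 := by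
    have hc : Tendsto (fun t ↦ ∑ i ∈ F, u t i) (𝓝 0) (𝓝 (∑ i ∈ F, u 0 i)) :=
      (continuous_finsetSum F fun i _ ↦ hcont i).tendsto 0
    refine hc.eventually_lt_const ?_
    simp only [hu, Complex.ofReal_zero, mul_zero, zero_mul, Complex.exp_zero, sub_self, norm_zero,
      Finset.sum_const_zero]
    positivity
  filter_upwards [hnear, hfin] with t ht htF
  -- One ε/4 comes from the terms in `F`; by `hsub`, the tail costs one at `s + t` and one at `s`.
  have hle : ∑' i, u t i ≤ 3 * (ε / 4) := by
    refine (h t).tsum_le_of_sum_le fun G ↦ ?_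
    have h1 : ∑ i ∈ G ∩ F, u t i ≤ ∑ i ∈ F, u t i :=
      Finset.sum_le_sum_of_subset_of_nonneg Finset.inter_subset_right fun i _ _ ↦ hu0 t i
    have hd : Disjoint (G \ F) F := Finset.sdiff_disjoint
    have h2 : ∑ i ∈ G \ F, u t i ≤ ε / 4 + ε / 4 :=
      (Finset.sum_le_sum fun i _ ↦ hsub s t i).trans
        (by rw [Finset.sum_add_distrib]; exact add_le_add (ht _ hd) (hsE _ hd))
    have h3 := Finset.sum_inter_add_sum_sdiff G F (u t)
    linarith
  rw [Real.dist_eq, sub_zero, abs_of_nonneg (tsum_nonneg fun i ↦ hu0 t i)]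
  linarith

/-- **Wintner's theorem**: if `∑ |h n| / n < ∞`, then `h * 1` has the mean value `∑ h n / n`. -/
theorem tendsto_mean_mul_zeta {h : ArithmeticFunction ℂ}
    (hs : Summable fun n : ℕ ↦ ‖h n‖ / (n : ℝ)) :
    Tendsto (fun N : ℕ ↦ (∑ n ∈ Finset.Ioc 0 N,
        (h * ((ArithmeticFunction.zeta : ArithmeticFunction ℕ) : ArithmeticFunction ℂ)) n) / (N : ℂ))
      atTop (𝓝 (∑' n : ℕ, h n / n)) := by
  have hterm (N n : ℕ) : ‖h n * ((N / n : ℕ) : ℂ) / N‖ ≤ ‖h n‖ / (n : ℝ) := by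
    rcases Nat.eq_zero_or_pos N with rfl | hN
    · simp only [Nat.cast_zero, div_zero, norm_zero]; positivity
    rw [norm_div, norm_mul, Complex.norm_natCast, Complex.norm_natCast, mul_div_assoc,
      div_eq_mul_inv ‖h n‖]
    refine mul_le_mul_of_nonneg_left ?_ (norm_nonneg _)
    rw [div_le_iff₀ (by exact_mod_cast hN)]
    exact (Nat.cast_div_le (α := ℝ)).trans_eq (by rw [div_eq_mul_inv, mul_comm])
  have hsum (N : ℕ) : (∑ n ∈ Finset.Ioc 0 N,
        (h * ((ArithmeticFunction.zeta : ArithmeticFunction ℕ) : ArithmeticFunction ℂ)) n) / (N : ℂ)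
      = ∑' n : ℕ, h n * ((N / n : ℕ) : ℂ) / N := by
    rw [ArithmeticFunction.sum_Ioc_mul_zeta_eq_sum, Finset.sum_div]
    -- The integer quotient `N / n` vanishes for n > N, so the finite sum is already the full
    -- series.
    refine (tsum_eq_sum fun n hn ↦ ?_).symm
    rcases Nat.eq_zero_or_pos n with rfl | hn0
    · simp
    · rw [Nat.div_eq_of_lt (by simp only [Finset.mem_Ioc] at hn; lia)]; simp
  simp_rw [hsum]
  refine tendsto_tsum_of_dominated_convergence hs (fun n ↦ ?_) (.of_forall fun N n ↦ hterm N n)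
  simp_rw [mul_div_assoc, div_eq_mul_inv (h n)]
  refine Tendsto.const_mul _ ?_
  have key : Tendsto (fun N : ℕ ↦ ((N / n : ℕ) : ℝ) / N) atTop (𝓝 ((n : ℝ)⁻¹)) := by
    have := (tendsto_nat_floor_mul_div_atTop (R := ℝ) (a := (n : ℝ)⁻¹) (by positivity)).comp
      tendsto_natCast_atTop_atTop
    refine this.congr fun N ↦ ?_
    simp only [Function.comp_apply]
    rw [inv_mul_eq_div, Nat.floor_div_eq_div]
  simpa [Function.comp_def] using (Complex.continuous_ofReal.tendsto _).comp key

/-! ### The convolution e^{itf} * μ and its Euler product -/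

variable {f : ArithmeticFunction ℝ} {t : ℝ}

theorem expArith_of_ne_zero {n : ℕ} (hn : n ≠ 0) :
    expArith f t n = Complex.exp (Complex.I * t * f n) := if_neg hn

theorem isMultiplicative_expArith (hf : IsAdditive f) (t : ℝ) :
    (expArith f t).IsMultiplicative := by
  refine ArithmeticFunction.IsMultiplicative.iff_ne_zero.2 ⟨?_, fun {m n} hm hn hmn ↦ ?_⟩
  · simp [expArith_of_ne_zero, hf.1]
  · rw [expArith_of_ne_zero hm, expArith_of_ne_zero hn, expArith_of_ne_zero (mul_ne_zero hm hn),
      hf.2 m n (Nat.pos_of_ne_zero hm) (Nat.pos_of_ne_zero hn) hmn, ← Complex.exp_add]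
    push_cast; ring_nf

theorem isMultiplicative_expConvMoebius (hf : IsAdditive f) (t : ℝ) :
    (expConvMoebius f t).IsMultiplicative :=
  (isMultiplicative_expArith hf t).mul ArithmeticFunction.isMultiplicative_moebius.intCast

theorem expConvMoebius_mul_zeta :
    expConvMoebius f t * ((ArithmeticFunction.zeta : ArithmeticFunction ℕ) : ArithmeticFunction ℂ) =
      expArith f t := by
  rw [expConvMoebius, mul_assoc, ArithmeticFunction.coe_moebius_mul_coe_zeta, mul_one]

theorem expConvMoebius_prime_pow_succ {p : ℕ} (hp : p.Prime) (k : ℕ) :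
    expConvMoebius f t (p ^ (k + 1)) =
      Complex.exp (Complex.I * t * f (p ^ (k + 1))) - Complex.exp (Complex.I * t * f (p ^ k)) := by
  have hs (k : ℕ) : ∑ i ∈ Finset.range (k + 1), expConvMoebius f t (p ^ i) =
      Complex.exp (Complex.I * t * f (p ^ k)) := by
    rw [← expArith_of_ne_zero (pow_ne_zero k hp.ne_zero), ← expConvMoebius_mul_zeta,
      ArithmeticFunction.coe_mul_zeta_apply, Nat.sum_divisors_prime_pow hp]
  rw [← hs, ← hs, Finset.sum_range_succ, add_sub_cancel_left]

/-- Factoring out the unimodular e^{itf(p^k)} leaves the shape |e^{itx} - 1| to which the Baire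
argument applies. -/
theorem norm_expConvMoebius_prime_pow_succ {p : ℕ} (hp : p.Prime) (k : ℕ) :
    ‖expConvMoebius f t (p ^ (k + 1))‖ =
      ‖Complex.exp (Complex.I * t * ((f (p ^ (k + 1)) - f (p ^ k) : ℝ) : ℂ)) - 1‖ := by
  have h1 : ‖Complex.exp (Complex.I * t * f (p ^ k))‖ = 1 := by
    rw [show Complex.I * t * f (p ^ k) = ((t * f (p ^ k) : ℝ) : ℂ) * Complex.I by push_cast; ring,
      Complex.norm_exp_ofReal_mul_I]
  rw [expConvMoebius_prime_pow_succ hp, ← one_mul ‖Complex.exp _ - 1‖, ← h1, ← norm_mul, mul_sub,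
    mul_one, ← Complex.exp_add]
  push_cast; ring_nf

theorem summable_exp_div_prime_pow (f : ArithmeticFunction ℝ) (t : ℝ) {p : ℕ} (hp : p.Prime) :
    Summable fun a : ℕ ↦ Complex.exp (Complex.I * t * f (p ^ a)) / (p : ℂ) ^ a := by
  refine Summable.of_norm_bounded (g := fun a : ℕ ↦ ((p : ℝ)⁻¹) ^ a)
    (summable_geometric_of_lt_one (by positivity)
      (inv_lt_one_of_one_lt₀ (by exact_mod_cast hp.one_lt))) fun a ↦ ?_
  rw [show Complex.I * t * f (p ^ a) = ((t * f (p ^ a) : ℝ) : ℂ) * Complex.I by push_cast; ring,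
    norm_div, Complex.norm_exp_ofReal_mul_I, norm_pow, Complex.norm_natCast, one_div, inv_pow]

/-- The local factor of the Dirichlet series of `e^{i t f} * μ` at `s = 1`. -/
theorem tsum_expConvMoebius_div_prime_pow (hf : IsAdditive f)
    (hs : Summable fun n : ℕ ↦ expConvMoebius f t n / n) {p : ℕ} (hp : p.Prime) :
    ∑' k : ℕ, expConvMoebius f t (p ^ k) / ((p ^ k : ℕ) : ℂ) =
      (1 - 1 / (p : ℂ)) * ∑' a : ℕ, Complex.exp (Complex.I * t * f (p ^ a)) / (p : ℂ) ^ a := by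
  have hg := summable_exp_div_prime_pow f t hp
  have hp0 : (p : ℂ) ≠ 0 := by exact_mod_cast hp.ne_zero
  have hk : Summable fun k : ℕ ↦ expConvMoebius f t (p ^ k) / ((p ^ k : ℕ) : ℂ) :=
    hs.comp_injective (Nat.pow_right_injective hp.two_le)
  have hsplit (k : ℕ) : expConvMoebius f t (p ^ (k + 1)) / ((p ^ (k + 1) : ℕ) : ℂ) =
      Complex.exp (Complex.I * t * f (p ^ (k + 1))) / (p : ℂ) ^ (k + 1) -
        1 / (p : ℂ) * (Complex.exp (Complex.I * t * f (p ^ k)) / (p : ℂ) ^ k) := by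
    rw [expConvMoebius_prime_pow_succ hp]
    push_cast
    field_simp
    ring
  rw [hk.tsum_eq_zero_add]
  simp_rw [hsplit]
  rw [Summable.tsum_sub ((summable_nat_add_iff 1).2 hg) (hg.mul_left _), tsum_mul_left, sub_mul,
    one_mul, hg.tsum_eq_zero_add]
  simp only [pow_zero, (isMultiplicative_expConvMoebius hf t).1, hf.1]
  simp
  ring

/-- The mean value `∑ (e^{i t f} * μ)(n) / n` of `e^{i t f}`. -/
noncomputable def meanValue (f : ArithmeticFunction ℝ) (t : ℝ) : ℂ :=
  ∑' n : ℕ, expConvMoebius f t n / n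

theorem summable_expConvMoebius_div
    (hs : Summable fun n : ℕ ↦ ‖expConvMoebius f t n‖ / (n : ℝ)) :
    Summable fun n : ℕ ↦ ‖expConvMoebius f t n / n‖ := by
  simpa using hs

theorem hasProd_tsum_expConvMoebius (hf : IsAdditive f)
    (hs : Summable fun n : ℕ ↦ ‖expConvMoebius f t n‖ / (n : ℝ)) :
    HasProd (fun p : Nat.Primes ↦
      ∑' k : ℕ, expConvMoebius f t ((p : ℕ) ^ k) / (((p : ℕ) ^ k : ℕ) : ℂ)) (meanValue f t) := by
  have hm := isMultiplicative_expConvMoebius hf t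
  refine EulerProduct.eulerProduct_hasProd (f := fun n : ℕ ↦ expConvMoebius f t n / n)
    (by simp [hm.1]) (fun {m n} hmn ↦ ?_) (summable_expConvMoebius_div hs) (by simp)
  rw [hm.2 hmn, Nat.cast_mul, mul_div_mul_comm]

theorem injective_prime_pow_succ :
    Function.Injective fun q : Nat.Primes × ℕ ↦ (q.1 : ℕ) ^ (q.2 + 1) := by
  rintro ⟨p, k⟩ ⟨q, l⟩ h
  obtain ⟨h1, h2⟩ := Nat.Prime.pow_inj p.2 q.2 h
  exact Prod.ext (Subtype.ext h1) h2

theorem continuousAt_meanValue (hf : IsAdditive f)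
    (hs : ∀ t : ℝ, Summable fun n : ℕ ↦ ‖expConvMoebius f t n‖ / (n : ℝ)) :
    ContinuousAt (meanValue f) 0 := by
  let a : Nat.Primes × ℕ → ℝ := fun q ↦ (((q.1 : ℕ) ^ (q.2 + 1) : ℕ) : ℝ)⁻¹
  let x : Nat.Primes × ℕ → ℝ := fun q ↦ f ((q.1 : ℕ) ^ (q.2 + 1)) - f ((q.1 : ℕ) ^ q.2)
  have heq (t : ℝ) (q : Nat.Primes × ℕ) : a q * ‖Complex.exp (Complex.I * t * x q) - 1‖ =
      ‖expConvMoebius f t ((q.1 : ℕ) ^ (q.2 + 1)) / (((q.1 : ℕ) ^ (q.2 + 1) : ℕ) : ℂ)‖ := by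
    rw [norm_div, norm_expConvMoebius_prime_pow_succ q.1.2, Complex.norm_natCast, div_eq_inv_mul]
  have hsum (t : ℝ) : Summable fun q ↦ a q * ‖Complex.exp (Complex.I * t * x q) - 1‖ := by
    simp_rw [heq]
    exact (summable_expConvMoebius_div (hs t)).comp_injective injective_prime_pow_succ
  have hlim := tendsto_tsum_mul_norm_exp_sub_one (fun q ↦ by positivity) hsum
  set S : ℝ → ℝ := fun t ↦ ∑' q, a q * ‖Complex.exp (Complex.I * t * x q) - 1‖ with hS
  -- |∏ (1 + c_p) - 1| ≤ exp(∑ |c_p|) - 1 holds for finite products and passes to the limit.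
  have hbound (t : ℝ) : ‖meanValue f t - 1‖ ≤ Real.exp (S t) - 1 := by
    have hprod := hasProd_tsum_expConvMoebius hf (hs t)
    refine le_of_tendsto ((hprod.sub_const 1).norm) (.of_forall fun s ↦ ?_)
    set c : Nat.Primes → ℂ := fun p ↦
      ∑' k : ℕ, expConvMoebius f t ((p : ℕ) ^ (k + 1)) / (((p : ℕ) ^ (k + 1) : ℕ) : ℂ) with hc
    have hfac (p : Nat.Primes) :
        ∑' k : ℕ, expConvMoebius f t ((p : ℕ) ^ k) / (((p : ℕ) ^ k : ℕ) : ℂ) = 1 + c p := by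
      have hk : Summable fun k : ℕ ↦ expConvMoebius f t ((p : ℕ) ^ k) / (((p : ℕ) ^ k : ℕ) : ℂ) :=
        (summable_expConvMoebius_div (hs t)).of_norm.comp_injective
          (Nat.pow_right_injective p.2.two_le)
      rw [hk.tsum_eq_zero_add]
      simp [(isMultiplicative_expConvMoebius hf t).1, hc]
    simp_rw [hfac]
    refine (s.norm_prod_one_add_sub_one_le c).trans ?_
    have hS' := hsum t
    have hcS (p : Nat.Primes) :
        ‖c p‖ ≤ ∑' k, a (p, k) * ‖Complex.exp (Complex.I * t * x (p, k)) - 1‖ := by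
      have hk := hS'.prod_factor p
      simp_rw [heq] at hk ⊢
      exact norm_tsum_le_tsum_norm hk
    have hle : ∑ p ∈ s, ‖c p‖ ≤ S t := by
      rw [hS]
      simp only
      rw [hS'.tsum_prod]
      exact (Finset.sum_le_sum fun p _ ↦ hcS p).trans
        (hS'.prod.sum_le_tsum s fun p _ ↦ tsum_nonneg fun k ↦ by positivity)
    gcongr
  have hS0 : S 0 = 0 := by simp [hS]
  have h0 : meanValue f 0 = 1 := by
    have := hbound 0
    rw [hS0, Real.exp_zero, sub_self] at this
    exact sub_eq_zero.1 (norm_le_zero_iff.1 this)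
  rw [ContinuousAt, h0, tendsto_iff_norm_sub_tendsto_zero]
  refine squeeze_zero (fun _ ↦ norm_nonneg _) hbound ?_
  simpa using ((Real.continuous_exp.tendsto 0).comp hlim).sub_const 1

end AdditiveArith

/-! ### Lévy continuity and weak convergence on the line -/

namespace MeasureTheory

/-- Lévy's continuity theorem, with existence of the limit: if the characteristic functions
converge pointwise to a function continuous at `0`, then this function is the characteristic
function of a probability measure, to which the measures converge weakly. -/
theorem ProbabilityMeasure.exists_tendsto_of_tendsto_charFun {E : Type*} [NormedAddCommGroup E]
    [InnerProductSpace ℝ E] [FiniteDimensional ℝ E] [MeasurableSpace E] [BorelSpace E]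
    {μ : ℕ → ProbabilityMeasure E} {φ : E → ℂ} (hφ : ContinuousAt φ 0)
    (h : ∀ t, Tendsto (fun n ↦ charFun (μ n : Measure E) t) atTop (𝓝 (φ t))) :
    ∃ P : ProbabilityMeasure E, Tendsto μ atTop (𝓝 P) ∧ ∀ t, charFun (P : Measure E) t = φ t := by
  have htight : IsTightMeasureSet (Set.range fun n ↦ (μ n : Measure E)) :=
    isTightMeasureSet_of_tendsto_charFun hφ h
  have hcompact : IsCompact (closure (Set.range μ)) := by
    refine isCompact_closure_of_isTightMeasureSet ?_
    convert htight using 1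
    ext; simp
  -- Tightness gives a limit along an ultrafilter; its characteristic function must be `φ`, which
  -- then forces convergence of the whole sequence.
  obtain ⟨P, -, hP⟩ := hcompact.ultrafilter_le_nhds ((Ultrafilter.of atTop).map μ)
    (by
      refine le_principal_iff.2 (mem_of_superset ?_ subset_closure)
      exact Filter.mem_map.2 (Filter.univ_mem' fun n ↦ ⟨n, rfl⟩))
  have hchar (t : E) : charFun (P : Measure E) t = φ t := by
    have hP' : Tendsto μ ((Ultrafilter.of atTop : Ultrafilter ℕ) : Filter ℕ) (𝓝 P) := hP
    rw [ProbabilityMeasure.tendsto_iff_forall_integral_rclike_tendsto ℂ] at hP'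
    have h1 := hP' (BoundedContinuousFunction.innerProbChar t)
    simp_rw [← charFun_eq_integral_innerProbChar] at h1
    exact tendsto_nhds_unique h1 ((h t).mono_left (Ultrafilter.of_le _))
  refine ⟨P, ProbabilityMeasure.tendsto_of_tendsto_charFun fun t ↦ ?_, hchar⟩
  rw [hchar]
  exact h t

/-- Weak convergence implies convergence of the distribution functions at the continuity points
of the limit. -/
theorem ProbabilityMeasure.tendsto_measureReal_Iic_of_continuousAt_cdf
    {μ : ℕ → ProbabilityMeasure ℝ} {P : ProbabilityMeasure ℝ} (h : Tendsto μ atTop (𝓝 P)) {y : ℝ}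
    (hy : ContinuousAt (ProbabilityTheory.cdf (P : Measure ℝ)) y) :
    Tendsto (fun n ↦ (μ n : Measure ℝ).real (Set.Iic y)) atTop
      (𝓝 (ProbabilityTheory.cdf (P : Measure ℝ) y)) := by
  -- Continuity of the cdf at `y` means that `P` has no atom there.
  have h0 : (P : Measure ℝ) (frontier (Set.Iic y)) = 0 := by
    rw [frontier_Iic, ← ProbabilityTheory.measure_cdf (P : Measure ℝ),
      StieltjesFunction.measure_singleton, hy.continuousWithinAt.leftLim_eq, sub_self,
      ENNReal.ofReal_zero]
  rw [ProbabilityTheory.cdf_eq_real]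
  exact (ENNReal.tendsto_toReal (measure_ne_top _ _)).comp
    (ProbabilityMeasure.tendsto_measure_of_null_frontier_of_tendsto' h h0)

end MeasureTheory

/-! ### Empirical laws of f and conclusion -/

namespace AdditiveArith

/-- The distribution of the values of `f` on `{1, …, n}` with the uniform probability. -/
noncomputable def empiricalMeasure (f : ArithmeticFunction ℝ) (n : ℕ) : Measure ℝ :=
  (n : ENNReal)⁻¹ • ∑ m ∈ Finset.Ioc 0 n, Measure.dirac (f m)

theorem isProbabilityMeasure_empiricalMeasure (f : ArithmeticFunction ℝ) {n : ℕ} (hn : n ≠ 0) :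
    IsProbabilityMeasure (empiricalMeasure f n) := by
  constructor
  simp only [empiricalMeasure, Measure.smul_apply, Measure.finsetSum_apply, measure_univ,
    Finset.sum_const, Nat.card_Ioc, smul_eq_mul, nsmul_eq_mul, mul_one, tsub_zero]
  exact ENNReal.inv_mul_cancel (by exact_mod_cast hn) (ENNReal.natCast_ne_top n)

theorem charFun_empiricalMeasure (f : ArithmeticFunction ℝ) (n : ℕ) (t : ℝ) :
    charFun (empiricalMeasure f n) t = (∑ m ∈ Finset.Ioc 0 n, expArith f t m) / (n : ℂ) := by
  rw [charFun_apply_real, empiricalMeasure, integral_smul_measure,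
    integral_finsetSum_measure fun m _ ↦ integrable_dirac (by simp), div_eq_inv_mul]
  simp only [integral_dirac, ENNReal.toReal_inv, ENNReal.toReal_natCast, Complex.real_smul]
  push_cast
  congr 1
  refine Finset.sum_congr rfl fun m hm ↦ ?_
  rw [expArith_of_ne_zero (Finset.mem_Ioc.1 hm).1.ne']
  ring_nf

theorem empiricalMeasure_real_Iic (f : ArithmeticFunction ℝ) (n : ℕ) (y : ℝ) :
    (empiricalMeasure f n).real (Set.Iic y) = distFun f n y := by
  have hset : {m : ℕ | 1 ≤ m ∧ m ≤ n ∧ f m ≤ y} =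
      (((Finset.Ioc 0 n).filter fun m ↦ f m ≤ y : Finset ℕ) : Set ℕ) := by
    ext m; simp [Nat.succ_le_iff, and_assoc]
  rw [distFun, hset, Set.ncard_coe_finset, empiricalMeasure, measureReal_def, Measure.smul_apply,
    Measure.finsetSum_apply, smul_eq_mul, ENNReal.toReal_mul, ENNReal.toReal_inv,
    ENNReal.toReal_natCast, div_eq_inv_mul]
  simp [Set.indicator_apply]

end AdditiveArith

open AdditiveArith in
theorem mainTheorem1 (f : ArithmeticFunction ℝ) (hf : AdditiveArith.IsAdditive f)
    (hsum : ∀ t : ℝ, Summable fun n : ℕ => ‖AdditiveArith.expConvMoebius f t n‖ / (n : ℝ)) :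
    ∃ P : MeasureTheory.Measure ℝ,
      AdditiveArith.HasLimitDistribution f P ∧
      ∀ t : ℝ,
        (∀ p : Nat.Primes, Summable fun a : ℕ =>
          Complex.exp (Complex.I * (t : ℂ) * (f ((p : ℕ) ^ a) : ℂ)) / ((p : ℕ) : ℂ) ^ a) ∧
        HasProd
          (fun p : Nat.Primes => (1 - 1 / ((p : ℕ) : ℂ)) *
            ∑' a : ℕ, Complex.exp (Complex.I * (t : ℂ) * (f ((p : ℕ) ^ a) : ℂ)) /
              ((p : ℕ) : ℂ) ^ a)
          (MeasureTheory.charFun P t) := by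
  -- The shift avoids n = 0, where the empirical measure is zero.
  let μ : ℕ → ProbabilityMeasure ℝ := fun n ↦
    ⟨empiricalMeasure f (n + 1), isProbabilityMeasure_empiricalMeasure f n.succ_ne_zero⟩
  obtain ⟨P, hP, hchar⟩ := ProbabilityMeasure.exists_tendsto_of_tendsto_charFun (μ := μ)
    (continuousAt_meanValue hf hsum) fun t ↦ by
      have hmean := (tendsto_mean_mul_zeta (hsum t)).comp (tendsto_add_atTop_nat 1)
      rw [expConvMoebius_mul_zeta] at hmean
      exact hmean.congr fun n ↦ (charFun_empiricalMeasure f (n + 1) t).symm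
  refine ⟨P, ⟨inferInstance, fun y hy ↦ ?_⟩, fun t ↦ ⟨fun p ↦ ?_, ?_⟩⟩
  · refine (tendsto_add_atTop_iff_nat 1).1 ?_
    simp_rw [← empiricalMeasure_real_Iic]
    exact ProbabilityMeasure.tendsto_measureReal_Iic_of_continuousAt_cdf hP hy
  · exact summable_exp_div_prime_pow f t p.2
  · rw [hchar]
    convert hasProd_tsum_expConvMoebius hf (hsum t) using 2 with p
    exact (tsum_expConvMoebius_div_prime_pow hf (summable_expConvMoebius_div (hsum t)).of_norm
      p.2).symm
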